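/- A camel walks in a desert $[0,\infty)$ with border at $0$. It can carry at most $2$ bananas on its back, and its stomach holds at most $2$ units of banana fuel. Each mile walked uses one unit of fuel, so the camel can only walk while its stomach is not empty. It eats only whole bananas, at its own position, and only when its stomach contains at most one unit of fuel; eating a banana adds one unit. Bananas can be picked up and put down freely at the position of the camel. Starting with an amount $M\ge 0$ of bananas ($M$ real) means that the camel is at $0$ with $\lfloor M\rfloor$ bananas next to it and $M-\lfloor M\rfloor$ units of fuel in its stomach. A round trip is a finite sequence of such actions (straight walks and meals) that ends with the camel at $0$. If the camel starts with an amount $M$ and has $s$ units of fuel in its stomach at the end of the trip, then the trip counts as a trip with $M-s$ bananas, i.e. the final banana fuel in the stomach is not counted as used fuel. Let $p_2:\mathbb{R}\to\mathbb{R}$, $p_2(x)=2^{\lfloor x\rfloor}\,(1+x-\lfloor x\rfloor)$. Theorem. For every real $N\ge 2$ there is exactly one real $p_2^{-1}(N)$ with $p_2\big(p_2^{-1}(N)\big)=N$, and $p_2^{-1}(N)$ is the maximum of all positions $c$ that are reached in some round trip which counts as a trip with exactly $N$ bananas. In other words, in the round trip variant of the case $B=2$, the camel can penetrate exactly $p_2^{-1}(N)$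 miles into the desert, provided the final banana fuel in its stomach is not counted as used fuel. -/

import Mathlib

namespace CamelBanana

/-- The piecewise linear function `p_B`, with `p_B(m) = (1 + 2/B)^m` at integers `m`. -/
noncomputable def p (B : ℕ) (x : ℝ) : ℝ :=
  (1 + 2 / (B : ℝ)) ^ ⌊x⌋ * (1 + 2 / (B : ℝ) * (x - (⌊x⌋ : ℝ)))

/-- A configuration: the position of the camel, the amount of banana fuel in its stomach, and the
positions of all uneaten bananas (a banana on the camel's back has the position of the camel).
The desert is the half line `[0, ∞)`, with its border at `0`. -/
structure State where
  pos : ℝ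
  fuel : ℝ
  bananas : Multiset ℝ

/-- The actions of a camel whose back has room for `B` bananas and whose stomach has room for
two. -/
inductive Step (B : ℕ) : State → State → Prop
  /-- The camel eats one whole banana at its position; its stomach holds at most one unit before. -/
  | eat (x f : ℝ) (S : Multiset ℝ) (hf : f ≤ 1) :
      Step B ⟨x, f, x ::ₘ S⟩ ⟨x, f + 1, S⟩
  /-- The camel walks straight from `x` to `y`, within the desert, at one unit of fuel per mile,
  carrying `j ≤ B` of the bananas at `x` along; picking up and putting down bananas is free. -/
  | walk (x y f : ℝ) (S : Multiset ℝ) (j : ℕ) (hj : j ≤ B) (hy : 0 ≤ y) (hf : |y - x| ≤ f) :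
      Step B ⟨x, f, Multiset.replicate j x + S⟩ ⟨y, f - |y - x|, Multiset.replicate j y + S⟩

/-- `t` can be reached from `s` by finitely many actions. -/
def Reaches (B : ℕ) : State → State → Prop :=
  Relation.ReflTransGen (Step B)

/-- The start with an amount `M ≥ 0` of bananas: the camel is at the border, with `⌊M⌋` bananas
next to it and `M - ⌊M⌋` units of banana fuel in its stomach. -/
noncomputable def start (M : ℝ) : State :=
  ⟨0, Int.fract M, Multiset.replicate ⌊M⌋₊ 0⟩

/-- Starting with an amount `M` of bananas, the camel can make a round trip which visits position
`c` and ends at the border with `s` units of banana fuel left in the stomach. -/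
def RoundTrip (B : ℕ) (M s c : ℝ) : Prop :=
  ∃ far final : State, Reaches B (start M) far ∧ far.pos = c ∧
    Reaches B far final ∧ final.pos = 0 ∧ final.fuel = s

/-- The depths which can be penetrated in a round trip for which exactly `N` units of fuel are
counted, when the banana fuel left in the stomach at the end is not counted. -/
def depths (B : ℕ) (N : ℝ) : Set ℝ :=
  {c | ∃ M s : ℝ, 0 ≤ M ∧ RoundTrip B M s c ∧ M - s = N}

end CamelBanana

namespace CamelBanana

/-! ### The function `p 2` -/

/-! Upper bound: let `L z` be the total distance walked beyond `z`. For a round trip and `z ≥ 1`, `2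
* L z ≤ L (z - 1)`: walking beyond `z` burns fuel that must have crossed the strip `[z - 1, z]`, and
with two bananas per load each mile in the strip raises a suitable potential by at most one. The
potential vanishes at the start and is nonnegative at the end. Iterating from `k = ⌊c⌋ - 1`, where
`L k ≥ 2 * (c - k)`, down to `0` gives `p 2 c ≤ L 0 ≤ N`.

Attainment: write `c = r + (k + 1)` with `0 ≤ r < 1`. With one unit in the stomach and `2 ^ (k + 1)`
bananas at `r`, halving the stock at each mile reaches `c` and returns to `r` with one unit
(`reaches_explore`); walking home leaves `1 - r`. The delicate point is stocking `r` without waste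
although meals are whole bananas and the stomach is bounded (`exists_supply`). -/

theorem p_two (x : ℝ) : p 2 x = 2 ^ ⌊x⌋ * (1 + Int.fract x) := by
  have h : (1 + 2 / ((2 : ℕ) : ℝ)) = 2 := by norm_num
  have h' : (2 / ((2 : ℕ) : ℝ)) = 1 := by norm_num
  rw [p, h, h', one_mul, Int.fract]

theorem p_two_add (k : ℕ) {r : ℝ} (h0 : 0 ≤ r) (h1 : r < 1) :
    p 2 (k + r) = 2 ^ k * (1 + r) := by
  have hf : ⌊(k : ℝ) + r⌋ = k := by
    rw [Int.floor_eq_iff]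
    push_cast
    constructor <;> linarith
  rw [p_two, Int.fract, hf]
  simp

theorem p_two_strictMono : StrictMono (p 2) := by
  intro x y hxy
  rw [p_two, p_two]
  have hx1 := Int.fract_lt_one x
  have hy0 := Int.fract_nonneg y
  have hle : ⌊x⌋ ≤ ⌊y⌋ := Int.floor_mono hxy.le
  rcases hle.eq_or_lt with h | h
  · have hxy' : Int.fract x < Int.fract y := by
      rw [Int.fract, Int.fract, h]
      linarith
    rw [h]
    gcongr
  · have hx2 : (0 : ℝ) < 2 ^ ⌊x⌋ := by positivity
    have hy2 : (0 : ℝ) < 2 ^ ⌊y⌋ := by positivity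
    have hpow : (2 : ℝ) ^ (⌊x⌋ + 1) ≤ 2 ^ ⌊y⌋ := zpow_le_zpow_right₀ (by norm_num) h
    rw [zpow_add_one₀ (by norm_num)] at hpow
    calc (2 : ℝ) ^ ⌊x⌋ * (1 + Int.fract x) < 2 ^ ⌊x⌋ * 2 := by gcongr; linarith
      _ ≤ 2 ^ ⌊y⌋ := hpow
      _ ≤ 2 ^ ⌊y⌋ * (1 + Int.fract y) := by nlinarith

theorem exists_eq_two_pow_mul {N : ℝ} (hN : 2 ≤ N) :
    ∃ (k : ℕ) (r : ℝ), 0 ≤ r ∧ r < 1 ∧ N = 2 ^ (k + 1) * (1 + r) := by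
  obtain ⟨k, hk, hk'⟩ := exists_nat_pow_near (x := N / 2) (y := 2) (by linarith) (by norm_num)
  have h2 : (0 : ℝ) < 2 ^ k := by positivity
  refine ⟨k, N / 2 ^ (k + 1) - 1, ?_, ?_, by field_simp; ring⟩
  · rw [sub_nonneg, one_le_div (by positivity), pow_succ]
    linarith
  · rw [sub_lt_iff_lt_add, div_lt_iff₀ (by positivity), pow_succ]
    rw [pow_succ] at hk'
    linarith

/-! ### The upper bound -/

/-- The part of the interval `[z - 1, z]` below `y`, as a length. -/
noncomputable def lift (z y : ℝ) : ℝ := max y (z - 1) - max y z + 1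

/-- The length of the part beyond `z` of a straight walk from `x` to `y`. -/
noncomputable def beyond (z x y : ℝ) : ℝ := |max y z - max x z|

/-- The potential of an amount `f` of fuel in the stomach, at distance `d` from a threshold. -/
noncomputable def fuelPotential (d f : ℝ) : ℝ := max 0 (f - 1 - d) + min 0 (f - 1 + d)

/-- The potential of a configuration, relative to the threshold `z`. -/
noncomputable def potential (z : ℝ) (s : State) : ℝ :=
  fuelPotential (1 - lift z s.pos) s.fuel + (s.bananas.map (lift z)).sum - lift z s.pos

theorem lift_nonneg (z y : ℝ) : 0 ≤ lift z y := by
  unfold lift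
  rcases max_cases y (z - 1) with h | h <;> rcases max_cases y z with h' | h' <;> linarith

theorem lift_le_one (z y : ℝ) : lift z y ≤ 1 := by
  unfold lift
  rcases max_cases y (z - 1) with h | h <;> rcases max_cases y z with h' | h' <;> linarith

theorem lift_zero {z : ℝ} (hz : 1 ≤ z) : lift z 0 = 0 := by
  rw [lift, max_eq_right (by linarith), max_eq_right (by linarith)]
  ring

theorem lift_mono (z : ℝ) : Monotone (lift z) := by
  intro x y h
  unfold lift
  rcases max_cases x (z - 1) with h1 | h1 <;> rcases max_cases y (z - 1) with h3 | h3 <;>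
    rcases max_cases x z with h2 | h2 <;> rcases max_cases y z with h4 | h4 <;> linarith

theorem beyond_nonneg (z x y : ℝ) : 0 ≤ beyond z x y := abs_nonneg _

theorem beyond_comm (z x y : ℝ) : beyond z x y = beyond z y x := abs_sub_comm _ _

theorem beyond_le (z x y : ℝ) : beyond z x y ≤ |y - x| := abs_max_sub_max_le_abs y x z

theorem beyond_sub_one (z x y : ℝ) :
    beyond (z - 1) x y = beyond z x y + |lift z y - lift z x| := by
  wlog h : x ≤ y generalizing x y
  · rw [beyond_comm, beyond_comm z, abs_sub_comm]
    exact this y x (le_of_not_ge h)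
  have h1 := max_le_max_right z h
  have h2 := max_le_max_right (z - 1) h
  have h3 := lift_mono z h
  rw [beyond, beyond, abs_of_nonneg (sub_nonneg.2 h1), abs_of_nonneg (sub_nonneg.2 h2),
    abs_of_nonneg (sub_nonneg.2 h3), lift, lift]
  ring

theorem beyond_eq_zero_or (z x y : ℝ) :
    beyond z x y = 0 ∨ lift z x = 1 ∨ lift z y = 1 := by
  rcases le_total x z with hx | hx
  · rcases le_total y z with hy | hy
    · left
      rw [beyond, max_eq_right hx, max_eq_right hy, sub_self, abs_zero]
    · right; right
      rw [lift, max_eq_left hy, max_eq_left (by linarith)]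
      ring
  · right; left
    rw [lift, max_eq_left hx, max_eq_left (by linarith)]
    ring

/-- `fuelPotential d` is `f - 1` with the dead zone `[-d, d]` cut out. Since `f - 1` lies in `[-1,
0]` before a meal, the gain is at most `1 - d`, the lift of the banana eaten. -/
theorem fuelPotential_eat {d f : ℝ} (hd0 : 0 ≤ d) (hd1 : d ≤ 1) (hf0 : 0 ≤ f) (hf1 : f ≤ 1) :
    fuelPotential d (f + 1) ≤ fuelPotential d f + (1 - d) := by
  unfold fuelPotential
  rcases max_cases 0 (f - 1 - d) with h1 | h1 <;> rcases min_cases 0 (f - 1 + d) with h2 | h2 <;>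
    rcases max_cases 0 (f + 1 - 1 - d) with h3 | h3 <;>
    rcases min_cases 0 (f + 1 - 1 + d) with h4 | h4 <;> linarith

/-- Both `f - d` and `f + d` drop by at least `u`. The dead zone is empty when `d = 0`, which
happens at an end of any walk that goes beyond the threshold. -/
theorem fuelPotential_walk {d d' f f' u : ℝ} (hd : 0 ≤ d) (hd' : 0 ≤ d') (hu : 0 ≤ u)
    (hf : f' + u + |d' - d| ≤ f) (h : u = 0 ∨ d = 0 ∨ d' = 0) :
    fuelPotential d' f' + u ≤ fuelPotential d f := by
  have ha := le_abs_self (d' - d)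
  have hb := neg_abs_le (d' - d)
  unfold fuelPotential
  rcases max_cases 0 (f - 1 - d) with h1 | h1 <;> rcases min_cases 0 (f - 1 + d) with h2 | h2 <;>
    rcases max_cases 0 (f' - 1 - d') with h3 | h3 <;>
    rcases min_cases 0 (f' - 1 + d') with h4 | h4 <;> rcases h with h | h | h <;> linarith

theorem fuelPotential_one {f : ℝ} (h0 : 0 ≤ f) (h2 : f ≤ 2) : fuelPotential 1 f = 0 := by
  rw [fuelPotential, max_eq_left (by linarith), min_eq_left (by linarith), add_zero]

theorem Step.potential_eat {z x f : ℝ} (S : Multiset ℝ) (hf0 : 0 ≤ f) (hf : f ≤ 1) :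
    potential z ⟨x, f + 1, S⟩ ≤ potential z ⟨x, f, x ::ₘ S⟩ := by
  have h := fuelPotential_eat (d := 1 - lift z x) (f := f)
    (sub_nonneg.2 (lift_le_one z x)) (by linarith [lift_nonneg z x]) hf0 hf
  simp only [potential, Multiset.map_cons, Multiset.sum_cons]
  linarith

theorem Step.potential_walk {z x y f : ℝ} (S : Multiset ℝ) {j : ℕ} (hj : j ≤ 2) :
    potential z ⟨y, f - |y - x|, Multiset.replicate j y + S⟩ + 2 * beyond z x y ≤
      potential z ⟨x, f, Multiset.replicate j x + S⟩ + beyond (z - 1) x y := by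
  have hstrip := beyond_sub_one z x y
  have hle := beyond_le (z - 1) x y
  have habs : |1 - lift z y - (1 - lift z x)| = |lift z y - lift z x| := by
    rw [sub_sub_sub_cancel_left, abs_sub_comm]
  have h := fuelPotential_walk (d := 1 - lift z x) (d' := 1 - lift z y) (f := f)
    (f' := f - |y - x|) (u := beyond z x y) (sub_nonneg.2 (lift_le_one z x))
    (sub_nonneg.2 (lift_le_one z y)) (beyond_nonneg z x y) (by rw [habs]; linarith)
    (by
      rcases beyond_eq_zero_or z x y with h | h | h
      · exact Or.inl h
      · exact Or.inr (Or.inl (by linarith))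
      · exact Or.inr (Or.inr (by linarith)))
  -- The camel's own lift is subtracted in the potential, so a load of `j` contributes `(j - 1)`
  -- times the change of lift, and `|j - 1| ≤ 1`.
  have hcarry : (j : ℝ) * (lift z y - lift z x) ≤
      |lift z y - lift z x| + (lift z y - lift z x) := by
    have hj0 : (0 : ℝ) ≤ j := Nat.cast_nonneg j
    have hj2 : (j : ℝ) ≤ 2 := by exact_mod_cast hj
    rcases abs_cases (lift z y - lift z x) with h | h <;> nlinarith
  simp only [potential, Multiset.map_add, Multiset.map_replicate, Multiset.sum_add,
    Multiset.sum_replicate, nsmul_eq_mul]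
  linarith

/-- Every run has a function `L` for which `L z` is the distance walked beyond `z`. -/
theorem Reaches.exists_length {s t : State} (h : Reaches 2 s t) (h0 : 0 ≤ s.fuel)
    (h2 : s.fuel ≤ 2) :
    0 ≤ t.fuel ∧ t.fuel ≤ 2 ∧ ∃ L : ℝ → ℝ,
      L 0 + t.fuel + t.bananas.card ≤ s.fuel + s.bananas.card ∧
      (∀ z, beyond z s.pos t.pos ≤ L z) ∧
      ∀ z, potential z t + 2 * L z ≤ potential z s + L (z - 1) := by
  induction h with
  | refl =>
    refine ⟨h0, h2, fun _ => 0, by simp, fun z => by simp [beyond], fun z => by simp⟩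
  | @tail t u _ hstep ih =>
    obtain ⟨ih0, ih2, L, hL0, hL1, hL2⟩ := ih
    cases hstep with
    | eat x f S hf =>
      simp only at ih0 ih2 hL0 hL1 ⊢
      refine ⟨by linarith, by linarith, L, ?_, hL1, fun z => ?_⟩
      · rw [Multiset.card_cons] at hL0
        push_cast at hL0
        linarith
      · linarith [Step.potential_eat (z := z) (x := x) S ih0 hf, hL2 z]
    | walk x y f S j hj hy hf =>
      simp only at ih0 ih2 hL0 hL1 ⊢
      refine ⟨by linarith, by linarith [abs_nonneg (y - x)], fun z => L z + beyond z x y,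
        ?_, fun z => ?_, fun z => ?_⟩
      · rw [Multiset.card_add, Multiset.card_replicate] at hL0 ⊢
        linarith [beyond_le 0 x y]
      · have := abs_sub_le (max y z) (max x z) (max s.pos z)
        simp only [beyond] at hL1 ⊢
        linarith [hL1 z]
      · linarith [Step.potential_walk (z := z) (x := x) (y := y) (f := f) S hj, hL2 z]

theorem p_two_le_of_mem_depths {N c : ℝ} (hc : 1 ≤ c) (h : c ∈ depths 2 N) : p 2 c ≤ N := by
  obtain ⟨M, s, hM, ⟨far, final, h1, rfl, h2, hpos, rfl⟩, rfl⟩ := h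
  set c := far.pos with hcdef
  obtain ⟨a0, a2, L, hL0, hL1, hL2⟩ := h1.exists_length (Int.fract_nonneg M)
    ((Int.fract_lt_one M).le.trans one_le_two)
  obtain ⟨b0, b2, K, hK0, hK1, hK2⟩ := h2.exists_length a0 a2
  have hstart : (start M).fuel + ((start M).bananas.card : ℝ) = M := by
    rw [start, Multiset.card_replicate, natCast_floor_eq_intCast_floor hM]
    exact Int.fract_add_floor M
  have htotal : L 0 + K 0 ≤ M - final.fuel := by
    have : (0 : ℝ) ≤ final.bananas.card := Nat.cast_nonneg _
    linarith
  have hdouble : ∀ z, 1 ≤ z → 2 * (L z + K z) ≤ L (z - 1) + K (z - 1) := by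
    intro z hz
    have hs : potential z (start M) = 0 := by
      simp only [start, potential, lift_zero hz, Multiset.map_replicate, Multiset.sum_replicate,
        smul_zero, sub_zero, add_zero]
      exact fuelPotential_one (Int.fract_nonneg M) ((Int.fract_lt_one M).le.trans one_le_two)
    have hf : 0 ≤ potential z final := by
      simp only [potential, hpos, lift_zero hz, sub_zero, fuelPotential_one b0 b2, zero_add]
      refine Multiset.sum_nonneg fun w hw => ?_
      obtain ⟨y, -, rfl⟩ := Multiset.mem_map.1 hw
      exact lift_nonneg z y
    linarith [hL2 z, hK2 z]
  have hpow : ∀ j : ℕ, 2 ^ j * (L j + K j) ≤ L 0 + K 0 := by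
    intro j
    induction j with
    | zero => simp
    | succ j ih =>
      have h := hdouble (j + 1) (by linarith [(Nat.cast_nonneg j : (0 : ℝ) ≤ j)])
      rw [add_sub_cancel_right] at h
      rw [pow_succ, mul_assoc]
      push_cast
      exact (mul_le_mul_of_nonneg_left h (by positivity)).trans ih
  -- Halving stops one mile before `⌊c⌋`: beyond `k` the bare way out and back already gives the
  -- last factor `2`.
  obtain ⟨k, hk⟩ : ∃ k : ℕ, ⌊c⌋ = k + 1 := by
    have : 1 ≤ ⌊c⌋ := Int.le_floor.2 (by exact_mod_cast hc)
    exact ⟨(⌊c⌋ - 1).toNat, by omega⟩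
  have hkc : (k : ℝ) + 1 ≤ c := by
    have := Int.floor_le c
    rw [hk] at this
    exact_mod_cast this
  have hk0 : (0 : ℝ) ≤ k := Nat.cast_nonneg k
  have hfar : 2 * (c - k) ≤ L k + K k := by
    have e1 := hL1 k
    have e2 := hK1 k
    rw [beyond_comm] at e1
    have h0 : (start M).pos = 0 := rfl
    rw [h0] at e1
    rw [hpos] at e2
    rw [beyond, max_eq_right hk0, ← hcdef, max_eq_left (by linarith), abs_sub_comm,
      abs_of_nonneg (by linarith)] at e1
    rw [beyond, max_eq_right hk0, ← hcdef, max_eq_left (by linarith), abs_sub_comm,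
      abs_of_nonneg (by linarith)] at e2
    linarith
  have hpc : p 2 c = 2 ^ k * (2 * (c - k)) := by
    rw [p_two, Int.fract, hk]
    push_cast
    rw [zpow_add_one₀ (by norm_num), zpow_natCast]
    ring
  rw [hpc]
  exact (mul_le_mul_of_nonneg_left hfar (by positivity)).trans ((hpow k).trans htotal)

/-! ### The strategy -/

open Multiset (replicate)

theorem Step.add_right {B : ℕ} {s t : State} (h : Step B s t) (T : Multiset ℝ) :
    Step B ⟨s.pos, s.fuel, s.bananas + T⟩ ⟨t.pos, t.fuel, t.bananas + T⟩ := by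
  cases h with
  | eat x f S hf =>
    simp only [Multiset.cons_add]
    exact Step.eat x f (S + T) hf
  | walk x y f S j hj hy hf =>
    simp only [add_assoc]
    exact Step.walk x y f (S + T) j hj hy hf

theorem Reaches.trans {B : ℕ} {s t u : State} (h : Reaches B s t) (h' : Reaches B t u) :
    Reaches B s u :=
  Relation.ReflTransGen.trans h h'

/-- Uneaten bananas can be added to both ends of a run. -/
theorem Reaches.frame {B : ℕ} {x y f g : ℝ} {S S' : Multiset ℝ}
    (h : Reaches B ⟨x, f, S⟩ ⟨y, g, S'⟩) (T : Multiset ℝ) {A A' : Multiset ℝ}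
    (hA : A = S + T) (hA' : A' = S' + T) : Reaches B ⟨x, f, A⟩ ⟨y, g, A'⟩ := by
  subst hA hA'
  exact Relation.ReflTransGen.lift (r := Step B) (p := Step B)
    (fun s : State => (⟨s.pos, s.fuel, s.bananas + T⟩ : State))
    (fun _ _ hs => Step.add_right hs T) _ _ h

theorem reaches_eat {B : ℕ} (x : ℝ) {f g : ℝ} (hf : f ≤ 1) (hg : g = f + 1) :
    Reaches B ⟨x, f, {x}⟩ ⟨x, g, 0⟩ := by
  subst hg
  exact Relation.ReflTransGen.single (Step.eat x f 0 hf)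

theorem reaches_carry {B : ℕ} (j : ℕ) (hj : j ≤ B) {x y f g : ℝ} (hy : 0 ≤ y) (hg : 0 ≤ g)
    (h : f = g + |y - x|) : Reaches B ⟨x, f, replicate j x⟩ ⟨y, g, replicate j y⟩ := by
  have h' := Step.walk x y f 0 j hj hy (by linarith)
  rw [add_zero, add_zero, show f - |y - x| = g by linarith] at h'
  exact Relation.ReflTransGen.single h'

theorem reaches_carry_out (j : ℕ) (hj : j ≤ 2) {x y f g : ℝ} (hx : 0 ≤ x) (hxy : x ≤ y)
    (hg : 0 ≤ g) (h : f = g + (y - x)) :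
    Reaches 2 ⟨x, f, replicate j x⟩ ⟨y, g, replicate j y⟩ :=
  reaches_carry j hj (hx.trans hxy) hg (by rw [abs_of_nonneg (sub_nonneg.2 hxy), h])

theorem reaches_return (j : ℕ) (hj : j ≤ 2) {x y f g : ℝ} (hy : 0 ≤ y) (hyx : y ≤ x)
    (hg : 0 ≤ g) (h : f = g + (x - y)) :
    Reaches 2 ⟨x, f, replicate j x⟩ ⟨y, g, replicate j y⟩ :=
  reaches_carry j hj hy hg (by rw [abs_sub_comm, abs_of_nonneg (sub_nonneg.2 hyx), h])

/-- A pair of bananas is moved from `x` to `y`, and the camel returns to `x`. -/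
theorem reaches_haul {x y f g : ℝ} (hx : 0 ≤ x) (hxy : x ≤ y) (hg : 0 ≤ g)
    (h : f = g + 2 * (y - x)) : Reaches 2 ⟨x, f, replicate 2 x⟩ ⟨x, g, replicate 2 y⟩ :=
  (reaches_carry_out 2 le_rfl hx hxy (g := g + (y - x)) (by linarith) (by linarith)).trans
    ((reaches_return 0 (by norm_num) hx hxy hg rfl).frame (replicate 2 y) (by simp) (by simp))

/-- Each cycle uses four bananas: two are delivered and two are eaten for the two miles walked. -/
theorem reaches_shuttle {x : ℝ} (hx : 0 ≤ x) (i : ℕ) :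
    Reaches 2 ⟨x, 1, replicate (4 * i) x⟩ ⟨x, 1, replicate (2 * i) (x + 1)⟩ := by
  induction i with
  | zero => exact Relation.ReflTransGen.refl
  | succ i ih =>
    have h1 := (reaches_eat (B := 2) x (f := 1) (g := 2) le_rfl (by norm_num)).frame
      (replicate (4 * i + 3) x) (A := replicate (4 * (i + 1)) x) (A' := replicate (4 * i + 3) x)
      (by simp only [← Multiset.nsmul_singleton]; module) (by simp)
    have h2 := (reaches_haul (x := x) (y := x + 1) (f := 2) (g := 0) hx (by linarith) le_rfl
      (by ring)).frame (replicate (4 * i + 1) x) (A := replicate (4 * i + 3) x)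
      (by simp only [← Multiset.nsmul_singleton]; module) rfl
    have h3 := (reaches_eat (B := 2) x (f := 0) (g := 1) zero_le_one (by norm_num)).frame
      (replicate 2 (x + 1) + replicate (4 * i) x)
      (A := replicate 2 (x + 1) + replicate (4 * i + 1) x)
      (by simp only [← Multiset.nsmul_singleton]; module) rfl
    have h4 := ih.frame (replicate 2 (x + 1))
      (A := 0 + (replicate 2 (x + 1) + replicate (4 * i) x))
      (A' := replicate (2 * (i + 1)) (x + 1))
      (by simp only [← Multiset.nsmul_singleton]; module)
      (by simp only [← Multiset.nsmul_singleton]; module)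
    exact ((h1.trans h2).trans h3).trans h4

/-- From `x`, with one unit in its stomach and `2 ^ (k + 1)` bananas next to it, the camel can visit
`x + (k + 1)` and be back at `x` with one unit in its stomach. -/
theorem reaches_explore (k : ℕ) : ∀ x : ℝ, 0 ≤ x → ∃ (f : ℝ) (S : Multiset ℝ),
    Reaches 2 ⟨x, 1, replicate (2 ^ (k + 1)) x⟩ ⟨x + (k + 1 : ℕ), f, S⟩ ∧
      Reaches 2 ⟨x + (k + 1 : ℕ), f, S⟩ ⟨x, 1, 0⟩ := by
  induction k with
  | zero =>
    intro x hx
    refine ⟨1, {x}, ?_, ?_⟩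
    · have h1 := (reaches_eat (B := 2) x (f := 1) (g := 2) le_rfl (by norm_num)).frame {x}
        (A := replicate (2 ^ (0 + 1)) x) (A' := {x})
        (by simp only [← Multiset.nsmul_singleton]; module) (by simp)
      have h2 := (reaches_carry_out 0 (by norm_num) (x := x) (y := x + (0 + 1 : ℕ)) (f := 2)
        (g := 1) hx (by simp) (by norm_num) (by norm_num)).frame {x} (A := {x}) (A' := {x})
        (by simp) (by simp)
      exact h1.trans h2
    · have h1 := (reaches_return 0 (by norm_num) (x := x + (0 + 1 : ℕ)) (y := x) (f := 1)
        (g := 0) hx (by simp) (by norm_num) (by norm_num)).frame {x} (A := {x}) (A' := {x})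
        (by simp) (by simp)
      exact h1.trans (reaches_eat x zero_le_one (by norm_num))
  | succ k ih =>
    intro x hx
    obtain ⟨f, S, hout, hback⟩ := ih (x + 1) (by linarith)
    have hpos : x + 1 + ((k + 1 : ℕ) : ℝ) = x + ((k + 1 + 1 : ℕ) : ℝ) := by push_cast; ring
    rw [hpos] at hout hback
    refine ⟨f, S + {x}, ?_, ?_⟩
    -- The last four bananas are treated apart: one is eaten, two are carried on a one-way trip, and
    -- one stays at `x` for the return.
    · obtain ⟨i, hi⟩ : ∃ i, 2 ^ k = i + 1 :=
        ⟨2 ^ k - 1, by have := Nat.one_le_two_pow (n := k); omega⟩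
      have hi1 : 2 ^ (k + 1) = 2 * i + 2 := by rw [pow_succ, hi]; ring
      have hi2 : 2 ^ (k + 1 + 1) = 4 * i + 4 := by rw [pow_succ, hi1]; ring
      rw [hi1] at hout
      rw [hi2]
      have h1 := (reaches_shuttle hx i).frame (replicate 4 x) (A := replicate (4 * i + 4) x)
        (by simp only [← Multiset.nsmul_singleton]; module) rfl
      have h2 := (reaches_eat (B := 2) x (f := 1) (g := 2) le_rfl (by norm_num)).frame
        (replicate (2 * i) (x + 1) + replicate 3 x)
        (A := replicate (2 * i) (x + 1) + replicate 4 x)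
        (by simp only [← Multiset.nsmul_singleton]; module) rfl
      have h3 := (reaches_carry_out 2 le_rfl (x := x) (y := x + 1) (f := 2) (g := 1) hx
        (by linarith) zero_le_one (by ring)).frame (replicate (2 * i) (x + 1) + {x})
        (A := 0 + (replicate (2 * i) (x + 1) + replicate 3 x))
        (by simp only [← Multiset.nsmul_singleton]; module) rfl
      have h4 := hout.frame {x} (A := replicate 2 (x + 1) + (replicate (2 * i) (x + 1) + {x}))
        (by simp only [← Multiset.nsmul_singleton]; module) rfl
      exact ((h1.trans h2).trans h3).trans h4
    · have h1 := hback.frame {x} rfl rfl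
      have h2 := (reaches_return 0 (by norm_num) (x := x + 1) (y := x) (f := 1) (g := 0) hx
        (by linarith) le_rfl (by ring)).frame {x} (A := 0 + {x}) (A' := {x}) (by simp) (by simp)
      exact (h1.trans h2).trans (reaches_eat x zero_le_one (by norm_num))

/-! ### Stocking a depth `r < 1` without waste -/

/-- With `h` units in its stomach, the camel can move `m` pairs of bananas from the border to `r`,
and arrive there with one unit in its stomach, walking `2 * m - 1` times between `0` and `r`. -/
def Supply (r : ℝ) (m : ℕ) (h : ℝ) : Prop :=
  ∃ q : ℕ, q + h = 2 * m + 2 * r * m - r + 1 ∧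
    Reaches 2 ⟨0, h, replicate q 0⟩ ⟨r, 1, replicate (2 * m) r⟩

/-- As `Supply`, but with a full stomach and with one of the pairs already moved to `x`. -/
def SupplyFrom (r : ℝ) (m : ℕ) (x : ℝ) : Prop :=
  ∃ q : ℕ, q + 4 = 2 * m + 2 * r * m - r + 1 - 2 * x ∧
    Reaches 2 ⟨0, 2, replicate q 0 + replicate 2 x⟩ ⟨r, 1, replicate (2 * m) r⟩

theorem supply_one {r : ℝ} (hr : 0 ≤ r) : Supply r 1 (1 + r) :=
  ⟨2, by push_cast; ring, reaches_carry_out 2 le_rfl le_rfl hr zero_le_one (by ring)⟩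

theorem supplyFrom_two {r : ℝ} (hr : 1 / 3 ≤ r) (hr1 : r ≤ 1) :
    SupplyFrom r 2 ((3 * r - 1) / 2) := by
  -- Chosen so that the walk `0 → r → x → r` has length `1`.
  set x := (3 * r - 1) / 2 with hx
  refine ⟨2, by rw [hx]; push_cast; ring, ?_⟩
  have h1 := (reaches_carry_out 2 le_rfl (x := 0) (y := r) (f := 2) (g := 2 - r) le_rfl
    (by linarith) (by linarith) (by ring)).frame (replicate 2 x) rfl rfl
  have h2 := (reaches_return 0 (by norm_num) (x := r) (y := x) (f := 2 - r)
    (g := 2 - r - (r - x)) (by linarith) (by linarith) (by linarith) (by ring)).frame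
    (replicate 2 r + replicate 2 x) (A := replicate 2 r + replicate 2 x)
    (A' := replicate 2 r + replicate 2 x) (by simp) (by simp)
  have h3 := (reaches_carry_out 2 le_rfl (x := x) (y := r) (f := 2 - r - (r - x)) (g := 1)
    (by linarith) (by linarith) (by linarith) (by rw [hx]; ring)).frame (replicate 2 r)
    (A := replicate 2 r + replicate 2 x) (A' := replicate (2 * 2) r)
    (by simp only [← Multiset.nsmul_singleton]; module)
    (by simp only [← Multiset.nsmul_singleton]; module)
  exact (h1.trans h2).trans h3

/-- A round trip to `r` in advance, without a meal. -/
theorem Supply.haul {r h : ℝ} {m : ℕ} (hr : 0 ≤ r) (h0 : 0 ≤ h) (H : Supply r m h) :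
    Supply r (m + 1) (h + 2 * r) := by
  obtain ⟨q, hq, hR⟩ := H
  refine ⟨q + 2, by push_cast; linarith, ?_⟩
  have h1 := (reaches_haul (x := 0) (y := r) (f := h + 2 * r) (g := h) le_rfl hr h0
    (by ring)).frame (replicate q 0) (A := replicate (q + 2) 0)
    (by simp only [← Multiset.nsmul_singleton]; module) rfl
  have h2 := hR.frame (replicate 2 r) (A := replicate 2 r + replicate q 0)
    (A' := replicate (2 * (m + 1)) r) (add_comm _ _)
    (by simp only [← Multiset.nsmul_singleton]; module)
  exact h1.trans h2

/-- A meal at the border in advance. -/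
theorem Supply.eat {r h : ℝ} {m : ℕ} (h2 : h ≤ 2) (H : Supply r m h) : Supply r m (h - 1) := by
  obtain ⟨q, hq, hR⟩ := H
  refine ⟨q + 1, by push_cast; linarith, ?_⟩
  exact ((reaches_eat (B := 2) 0 (f := h - 1) (g := h) (by linarith) (by ring)).frame
    (replicate q 0) (by simp only [← Multiset.nsmul_singleton]; module) (by simp)).trans hR

theorem SupplyFrom.eat {r x : ℝ} {m : ℕ} (H : SupplyFrom r m x) :
    ∃ q : ℕ, q + 2 = 2 * m + 2 * r * m - r + 1 - 2 * x ∧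
      Reaches 2 ⟨0, 0, replicate q 0 + replicate 2 x⟩ ⟨r, 1, replicate (2 * m) r⟩ := by
  obtain ⟨q, hq, hR⟩ := H
  refine ⟨q + 2, by push_cast; linarith, ?_⟩
  have h1 := (reaches_eat (B := 2) 0 (f := 0) (g := 1) zero_le_one (by norm_num)).frame
    (replicate (q + 1) 0 + replicate 2 x) (A := replicate (q + 2) 0 + replicate 2 x)
    (by simp only [← Multiset.nsmul_singleton]; module) rfl
  have h2 := (reaches_eat (B := 2) 0 (f := 1) (g := 2) le_rfl (by norm_num)).frame
    (replicate q 0 + replicate 2 x) (A := 0 + (replicate (q + 1) 0 + replicate 2 x))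
    (A' := replicate q 0 + replicate 2 x)
    (by simp only [← Multiset.nsmul_singleton]; module) (by simp)
  exact (h1.trans h2).trans hR

/-- The pair at `x` is brought there by a round trip from the border. -/
theorem SupplyFrom.supply {r x : ℝ} {m : ℕ} (hx : 0 ≤ x) (H : SupplyFrom r m x) :
    Supply r m (2 * x) := by
  obtain ⟨q, hq, hR⟩ := H.eat
  refine ⟨q + 2, by push_cast; linarith, ?_⟩
  exact ((reaches_haul (x := 0) (y := x) (f := 2 * x) (g := 0) le_rfl hx le_rfl
    (by ring)).frame (replicate q 0) (A := replicate (q + 2) 0)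
    (A' := replicate q 0 + replicate 2 x)
    (by simp only [← Multiset.nsmul_singleton]; module) (add_comm _ _)).trans hR

/-- A round trip from the border which moves one pair to `r`, and another one from `x` to `y`. -/
theorem reaches_haul_haul {r x y g : ℝ} (hx : 0 ≤ x) (hxy : x ≤ y) (hyr : y ≤ r) (hg : 0 ≤ g)
    (h : 2 = g + 2 * r + 2 * (y - x)) :
    Reaches 2 ⟨0, 2, replicate 2 0 + replicate 2 x⟩ ⟨0, g, replicate 2 r + replicate 2 y⟩ := by
  have h1 := (reaches_carry_out 2 le_rfl (x := 0) (y := r) (f := 2) (g := 2 - r) le_rfl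
    (by linarith) (by linarith) (by ring)).frame (replicate 2 x) rfl rfl
  have h2 := (reaches_return 0 (by norm_num) (x := r) (y := x) (f := 2 - r)
    (g := 2 - r - (r - x)) (by linarith) (by linarith) (by linarith) (by ring)).frame
    (replicate 2 r + replicate 2 x) (A := replicate 2 r + replicate 2 x)
    (A' := replicate 2 r + replicate 2 x) (by simp) (by simp)
  have h3 := (reaches_carry_out 2 le_rfl (x := x) (y := y) (f := 2 - r - (r - x)) (g := g + y)
    hx hxy (by linarith) (by linarith)).frame (replicate 2 r)
    (A := replicate 2 r + replicate 2 x) (A' := replicate 2 r + replicate 2 y)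
    (add_comm _ _) (add_comm _ _)
  have h4 := (reaches_return 0 (by norm_num) (x := y) (y := 0) (f := g + y) (g := g) le_rfl
    (by linarith) hg (by ring)).frame (replicate 2 r + replicate 2 y)
    (A := replicate 2 r + replicate 2 y) (A' := replicate 2 r + replicate 2 y)
    (by simp) (by simp)
  exact ((h1.trans h2).trans h3).trans h4

/-- A full stomach covers the `2 * r` of a round trip to `r`; the remaining `2 - 2 * r` advances a
waiting pair by `1 - r`. -/
theorem SupplyFrom.shift {r x : ℝ} {m : ℕ} (hr : r ≤ 1) (hx : 1 - r ≤ x) (hxr : x ≤ r)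
    (H : SupplyFrom r m x) : SupplyFrom r (m + 1) (x - (1 - r)) := by
  obtain ⟨q, hq, hR⟩ := H.eat
  refine ⟨q + 2, by push_cast; linarith, ?_⟩
  have h1 := (reaches_haul_haul (r := r) (x := x - (1 - r)) (y := x) (g := 0) (by linarith)
    (by linarith) hxr le_rfl (by ring)).frame (replicate q 0)
    (A := replicate (q + 2) 0 + replicate 2 (x - (1 - r)))
    (by simp only [← Multiset.nsmul_singleton]; module) rfl
  have h2 := hR.frame (replicate 2 r) (A := replicate 2 r + replicate 2 x + replicate q 0)
    (A' := replicate (2 * (m + 1)) r) (by simp only [← Multiset.nsmul_singleton]; module)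
    (by simp only [← Multiset.nsmul_singleton]; module)
  exact h1.trans h2

/-- When a meal and a haul in advance would need too much fuel, a waiting pair absorbs the surplus:
the new trip takes it from `x` to `r` and comes home with `h - 1`. -/
theorem Supply.supplyFrom {r h : ℝ} {m : ℕ} (h1 : 1 ≤ h) (h2 : h ≤ 2) (hr : h ≤ 3 - 2 * r)
    (hx : 3 ≤ h + 4 * r) (H : Supply r m h) : SupplyFrom r (m + 2) ((h - 3 + 4 * r) / 2) := by
  obtain ⟨q, hq, hR⟩ := H.eat h2
  set x := (h - 3 + 4 * r) / 2 with hxdef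
  refine ⟨q + 2, by push_cast; linarith, ?_⟩
  have h1 := (reaches_haul_haul (r := r) (x := x) (y := r) (g := h - 1) (by linarith)
    (by linarith) le_rfl (by linarith) (by linarith)).frame (replicate q 0)
    (A := replicate (q + 2) 0 + replicate 2 x)
    (by simp only [← Multiset.nsmul_singleton]; module) rfl
  have h2 := hR.frame (replicate 4 r) (A := replicate 2 r + replicate 2 r + replicate q 0)
    (A' := replicate (2 * (m + 2)) r) (by simp only [← Multiset.nsmul_singleton]; module)
    (by simp only [← Multiset.nsmul_singleton]; module)
  exact h1.trans h2

/-- The plan is built backwards, prepending trips. For `r ≤ 1 / 2`, hauls and meals keep `h` in `[1,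
2]`. -/
theorem exists_supply {r : ℝ} (hr : 0 ≤ r) (hr1 : r < 1) (m : ℕ) :
    ∃ h, 0 ≤ h ∧ h ≤ 2 ∧ Supply r (m + 1) h := by
  rcases le_total r (1 / 2) with hr2 | hr2
  · suffices ∃ h, 1 ≤ h ∧ h ≤ 2 ∧ Supply r (m + 1) h by
      obtain ⟨h, h1, h2, H⟩ := this
      exact ⟨h, by linarith, h2, H⟩
    induction m with
    | zero => exact ⟨1 + r, by linarith, by linarith, supply_one hr⟩
    | succ m ih =>
      obtain ⟨h, h1, h2, H⟩ := ih
      rcases le_total (h + 2 * r) 2 with h3 | h3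
      · exact ⟨h + 2 * r, by linarith, h3, H.haul hr (by linarith)⟩
      · exact ⟨h - 1 + 2 * r, by linarith, by linarith, (H.eat h2).haul hr (by linarith)⟩
  -- The bound `h ≤ 3 - 2 * r` says that one more meal and haul in advance needs at most a full
  -- stomach; otherwise a pair waits at some `x` in `[1 / 2, r]`.
  · have key : ∀ m : ℕ, (∃ h, 1 ≤ h ∧ h ≤ 3 - 2 * r ∧ Supply r (m + 1) h) ∨
        ∃ x, 1 / 2 ≤ x ∧ x ≤ r ∧ SupplyFrom r (m + 2) x := by
      intro m
      induction m with
      | zero =>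
        rcases le_total r (2 / 3) with h | h
        · exact Or.inl ⟨1 + r, by linarith, by linarith, supply_one hr⟩
        · exact Or.inr ⟨(3 * r - 1) / 2, by linarith, by linarith,
            supplyFrom_two (by linarith) hr1.le⟩
      | succ m ih =>
        rcases ih with ⟨h, h1, h2, H⟩ | ⟨x, h1, h2, H⟩
        · rcases le_total (h - 1 + 2 * r) (3 - 2 * r) with h3 | h3
          · exact Or.inl ⟨h - 1 + 2 * r, by linarith, h3,
              (H.eat (by linarith)).haul hr (by linarith)⟩
          · exact Or.inr ⟨(h - 3 + 4 * r) / 2, by linarith, by linarith,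
              H.supplyFrom h1 (by linarith) h2 (by linarith)⟩
        · rcases le_total x (3 / 2 - r) with h3 | h3
          · exact Or.inl ⟨2 * x, by linarith, by linarith, H.supply (by linarith)⟩
          · exact Or.inr ⟨x - (1 - r), by linarith, by linarith,
              H.shift hr1.le (by linarith) h2⟩
    cases m with
    | zero => exact ⟨1 + r, by linarith, by linarith, supply_one hr⟩
    | succ m =>
      rcases key m with ⟨h, h1, h2, H⟩ | ⟨x, h1, h2, H⟩
      · exact ⟨h - 1 + 2 * r, by linarith, by linarith,
          (H.eat (by linarith)).haul hr (by linarith)⟩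
      · exact ⟨2 * x, by linarith, by linarith, H.supply (by linarith)⟩

/-- `start` leaves less than one unit in the stomach, so up to two initial meals at the border raise
it to `h`. -/
theorem reaches_of_start {h : ℝ} (h0 : 0 ≤ h) (h2 : h ≤ 2) (q : ℕ) :
    Reaches 2 (start (q + h)) ⟨0, h, replicate q 0⟩ := by
  obtain ⟨e, f, he, hf0, hf1, hR⟩ : ∃ (e : ℕ) (f : ℝ), h = e + f ∧ 0 ≤ f ∧ f < 1 ∧
      Reaches 2 ⟨0, f, replicate e 0⟩ ⟨0, h, 0⟩ := by
    rcases lt_or_ge h 1 with h1 | h1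
    · exact ⟨0, h, by simp, h0, h1, Relation.ReflTransGen.refl⟩
    · rcases h2.lt_or_eq with h3 | rfl
      · exact ⟨1, h - 1, by push_cast; ring, by linarith, by linarith,
          reaches_eat 0 (by linarith) (by ring)⟩
      · refine ⟨2, 0, by norm_num, le_rfl, one_pos, ?_⟩
        exact ((reaches_eat (B := 2) 0 (f := 0) (g := 1) zero_le_one (by norm_num)).frame
          {0} rfl rfl).trans ((reaches_eat 0 le_rfl (by norm_num)).frame 0 (by simp) rfl)
  have hfl : ⌊(q : ℝ) + h⌋ = ((q + e : ℕ) : ℤ) := by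
    rw [Int.floor_eq_iff]
    push_cast
    constructor <;> linarith
  have hfn : ⌊(q : ℝ) + h⌋₊ = q + e := by
    rw [← Int.floor_toNat, hfl, Int.toNat_natCast]
  have hfr : Int.fract ((q : ℝ) + h) = f := by
    rw [Int.fract, hfl, he]
    push_cast
    ring
  rw [start, hfn, hfr]
  exact hR.frame (replicate q 0) (by simp only [← Multiset.nsmul_singleton]; module) (by simp)

theorem add_mem_depths (k : ℕ) {r : ℝ} (hr : 0 ≤ r) (hr1 : r < 1) :
    r + (k + 1 : ℕ) ∈ depths 2 (2 ^ (k + 1) * (1 + r)) := by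
  obtain ⟨m, hm⟩ : ∃ m, 2 ^ k = m + 1 :=
    ⟨2 ^ k - 1, by have := Nat.one_le_two_pow (n := k); omega⟩
  obtain ⟨h, h0, h2, q, hq, hR⟩ := exists_supply hr hr1 m
  obtain ⟨f, S, hout, hback⟩ := reaches_explore k r hr
  have hm' : 2 * (m + 1) = 2 ^ (k + 1) := by rw [← hm, pow_succ, mul_comm]
  rw [hm'] at hR
  refine ⟨q + h, 1 - r, by positivity, ⟨_, ⟨0, 1 - r, 0⟩,
    ((reaches_of_start h0 h2 q).trans hR).trans hout, rfl, hback.trans ?_, rfl, rfl⟩, ?_⟩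
  · exact reaches_return 0 (by norm_num) le_rfl hr (by linarith) (by ring)
  · have : (2 : ℝ) ^ (k + 1) = 2 * (m + 1) := by exact_mod_cast hm'.symm
    rw [hq, this]
    push_cast
    ring

end CamelBanana

theorem mainTheorem10 (N : ℝ) (hN : 2 ≤ N) :
    ∃ c : ℝ, (∀ y : ℝ, CamelBanana.p 2 y = N ↔ y = c) ∧
      IsGreatest (CamelBanana.depths 2 N) c := by
  obtain ⟨k, r, hr, hr1, rfl⟩ := CamelBanana.exists_eq_two_pow_mul hN
  have hp : CamelBanana.p 2 (r + (k + 1 : ℕ)) = 2 ^ (k + 1) * (1 + r) := by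
    rw [add_comm r]
    exact CamelBanana.p_two_add (k + 1) hr hr1
  refine ⟨r + (k + 1 : ℕ), fun y => ?_, CamelBanana.add_mem_depths k hr hr1, fun c hc => ?_⟩
  · rw [← hp]
    exact CamelBanana.p_two_strictMono.injective.eq_iff
  · rcases le_total 1 c with h | h
    · rw [← CamelBanana.p_two_strictMono.le_iff_le, hp]
      exact CamelBanana.p_two_le_of_mem_depths h hc
    · push_cast
      linarith [(Nat.cast_nonneg k : (0 : ℝ) ≤ k)]
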